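/- For integers $t\ge 2$ and $n\ge 1$ let $Q(t,n)$ be the minimum independence number of a $K_t$-free graph on $n$ vertices. For a graph $H$, $n\ge 1$ and a real number $x$, let $\mathrm{RT}(n,H,x)$ be the maximum number of edges in an $n$-vertex graph that does not contain $H$ as a subgraph and has independence number at most $x$ (and $0$ if there is no such graph). For a function $f$ put \[ \overline{\rho\tau}(H,f)=\limsup_{n\to\infty}\frac{\mathrm{RT}(n,H,f(n))}{n^2},\qquad \rho\tau(H,o(f))=\lim_{\delta\to 0^+}\overline{\rho\tau}(H,\delta f). \] Theorem. The limit defining $\rho\tau(K_{12},o(Q(4,n)))$ exists, and \[ \rho\tau(K_{12},o(Q(4,n)))\le \frac{4}{13}. \] -/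

import Mathlib

open Filter Topology

noncomputable section

namespace RamseyTuran

/-- The inverse Ramsey number `Q(t, n)`: the minimum independence number of a `K_t`-free graph on
`n` vertices. (For `t ≥ 2` the edgeless graph shows that the minimum is over a nonempty set.) -/
def inverseRamsey (t n : ℕ) : ℕ :=
  sInf {a : ℕ | ∃ G : SimpleGraph (Fin n), G.CliqueFree t ∧ G.indepNum = a}

/-- The Ramsey-Turán number `RT(n, H, x)`: the maximum number of edges of an `n`-vertex graph that
contains no copy of `H` and has independence number at most the real number `x`.
The set of edge counts is finite, so the supremum is a maximum as soon as such a graph exists;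
if there is none, the value is `0`. -/
def ramseyTuran {W : Type*} (n : ℕ) (H : SimpleGraph W) (x : ℝ) : ℕ :=
  sSup {e : ℕ | ∃ G : SimpleGraph (Fin n),
    H.Free G ∧ (G.indepNum : ℝ) ≤ x ∧ G.edgeSet.ncard = e}

/-- The upper Ramsey-Turán density `limsup_{n → ∞} RT(n, H, f(n)) / n ^ 2`. The quotients lie in
`[0, 1/2]`, so this is the genuine upper limit. -/
def upperDensity {W : Type*} (H : SimpleGraph W) (f : ℕ → ℝ) : ℝ :=
  limsup (fun n : ℕ => (ramseyTuran n H (f n) : ℝ) / (n : ℝ) ^ 2) atTop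

/-- `c` is the Ramsey-Turán density of `H` with respect to `o(f)`: the limit, as `δ → 0+`, of the
(upper) Ramsey-Turán density of `H` with respect to `δ f`. -/
def IsLittleODensity {W : Type*} (H : SimpleGraph W) (f : ℕ → ℝ) (c : ℝ) : Prop :=
  Tendsto (fun δ : ℝ => upperDensity H (fun n => δ * f n)) (𝓝[>] 0) (𝓝 c)

end RamseyTuran

end

namespace RamseyTuran

/-! If α(G) is small compared with Q(4,n), every vertex set X of linear size contains a K_4:
otherwise a bounded number of disjoint copies of G[X] would yield a K_4-free graph on n vertices
with too small an independence number. It remains to bound the edges of a K_12-free graph with this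
property.

Apply Szemerédi regularity and give each regular pair a weight in {0,...,4}, its density rounded up
in units of 1/4. Suppose a 4-clique of vertices of typical degree is found in a cluster. Averaging
shows that some a of its vertices have a large common neighbourhood in one other cluster joined to
it by weight at least a; a union bound keeps the common neighbourhood in the remaining clusters
large when their weights w satisfy a(5 - w) ≤ 4. Iterating produces cliques: `Emb` records this
bookkeeping and `Emb.exists_isNClique` realizes it. Hence no `Emb` configuration on at most nine
clusters may reach 12.

The weighted Turán problem that is left is solved by the Lagrangian method. A maximizer of the
quadratic form on the simplex with minimal support lives on a clique of positive weights and has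
equal partial derivatives there (`exists_maximizer_clique`). Such a clique has at most 8 clusters,
and `le_of_clique` bounds the maximum by 32/13 according to its size; the value 32/13 comes from a
triangle with weights 4, 4, 3. Since weights count quarters and each edge is counted twice, this
gives (32/13)/8 = 4/13. -/

/-- `HereditarilyDense G s τ A B`: all subsets of `A` and `B` with at least `s` elements span
more than a `τ`-fraction of the possible edges. -/
def HereditarilyDense {α : Type*} (G : SimpleGraph α) [DecidableRel G.Adj]
    (s τ : ℝ) (A B : Finset α) : Prop :=
  ∀ X ⊆ A, ∀ Y ⊆ B, s ≤ X.card → s ≤ Y.card →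
    τ * (X.card * Y.card) < ((G.interedges X Y).card : ℝ)

/-- `Emb w I K`: processing the clusters of `I` one at a time, and retaining in each of them as
many vertices of a `4`-clique as the weights `w` allow, one finds a clique with `K` vertices. -/
inductive Emb {ι : Type*} [DecidableEq ι] (w : ι → ι → ℕ) : Finset ι → ℕ → Prop
  | base (i : ι) : Emb w {i} 4
  | step (i j₀ : ι) (I : Finset ι) (K a : ℕ) (hi : i ∉ I) (hj₀ : j₀ ∈ I) (ha : 1 ≤ a)
      (ha4 : a ≤ 4) (haw : a ≤ w i j₀) (h : ∀ j ∈ I, j ≠ j₀ → 5 * a ≤ a * w i j + 4)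
      (hK : Emb w I K) : Emb w (insert i I) (K + a)

/-! ### Embedding cliques into dense clusters. -/

section Clusters

variable {α : Type*} (G : SimpleGraph α) [DecidableRel G.Adj]

lemma card_interedges_eq_sum (X Y : Finset α) :
    (G.interedges X Y).card = ∑ x ∈ X, (Y.filter (G.Adj x)).card := by
  rw [SimpleGraph.interedges_def, Finset.card_filter, Finset.sum_product]
  exact Finset.sum_congr rfl fun x _ => (Finset.card_filter _ _).symm

-- If there were `s` such vertices, they and `Y` would form a pair of large subsets of too small a
-- density.
variable {G} in
lemma HereditarilyDense.card_low_degree_lt {s τ : ℝ} {A B U Y : Finset α}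
    (h : HereditarilyDense G s τ A B) (hU : U ⊆ A) (hY : Y ⊆ B) (hs : s ≤ Y.card) :
    ((U.filter fun x => ((Y.filter (G.Adj x)).card : ℝ) ≤ τ * Y.card).card : ℝ) < s := by
  by_contra! hc
  have h1 := h _ ((Finset.filter_subset _ _).trans hU) Y hY hc hs
  rw [card_interedges_eq_sum] at h1
  push_cast at h1
  have h2 := Finset.sum_le_sum (s := U.filter fun x => ((Y.filter (G.Adj x)).card : ℝ) ≤ τ * Y.card)
    (f := fun x => ((Y.filter (G.Adj x)).card : ℝ)) (g := fun _ => τ * Y.card)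
    (fun x hx => (Finset.mem_filter.1 hx).2)
  rw [Finset.sum_const, nsmul_eq_mul] at h2
  nlinarith

variable [DecidableEq α]

/-- The common neighbourhood of a set of vertices of large degree, by the union bound. -/
lemma card_common_nbhd_ge {S Y : Finset α} {τ κ : ℝ}
    (h : ∀ x ∈ S, τ * Y.card ≤ ((Y.filter (G.Adj x)).card : ℝ))
    (hS : S.card * (1 - τ) ≤ 1 - κ) :
    κ * Y.card ≤ ((Y.filter fun y => ∀ x ∈ S, G.Adj x y).card : ℝ) := by
  have h1 : Y.filter (fun y => ¬ ∀ x ∈ S, G.Adj x y) ⊆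
      S.biUnion fun x => Y.filter fun y => ¬ G.Adj x y := by
    intro y hy
    simp only [Finset.mem_filter, not_forall, Finset.mem_biUnion] at hy ⊢
    obtain ⟨hy, x, hx, hxy⟩ := hy
    exact ⟨x, hx, hy, hxy⟩
  have h2 : ((Y.filter (fun y => ¬ ∀ x ∈ S, G.Adj x y)).card : ℝ) ≤
      S.card * ((1 - τ) * Y.card) := by
    calc _ ≤ ((∑ x ∈ S, (Y.filter fun y => ¬ G.Adj x y).card : ℕ) : ℝ) := by
            exact_mod_cast (Finset.card_le_card h1).trans Finset.card_biUnion_le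
      _ = ∑ x ∈ S, ((Y.filter fun y => ¬ G.Adj x y).card : ℝ) := by push_cast; rfl
      _ ≤ ∑ x ∈ S, (1 - τ) * (Y.card : ℝ) := by
            refine Finset.sum_le_sum fun x hx => ?_
            have := h x hx
            have h3 : ((Y.filter (G.Adj x)).card : ℝ) + (Y.filter fun y => ¬ G.Adj x y).card
              = Y.card := by exact_mod_cast Finset.card_filter_add_card_filter_not _
            linarith
      _ = _ := by rw [Finset.sum_const, nsmul_eq_mul]
  have h3 : ((Y.filter fun y => ∀ x ∈ S, G.Adj x y).card : ℝ) +
      (Y.filter fun y => ¬ ∀ x ∈ S, G.Adj x y).card = Y.card := by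
    exact_mod_cast Finset.card_filter_add_card_filter_not _
  have h4 : (0 : ℝ) ≤ Y.card := by positivity
  nlinarith

/-- Among four vertices of degree more than `(a - 1) / 4`, some `a` have a large common
neighbourhood, by averaging. -/
lemma exists_subset_card_common_nbhd_ge {Q Y : Finset α} {η : ℝ} {a : ℕ} (hQ : Q.card = 4)
    (ha : 1 ≤ a)
    (ha4 : a ≤ 4) (hη : 0 ≤ η)
    (h : ∀ x ∈ Q, (((a : ℝ) - 1) / 4 + η) * Y.card ≤ ((Y.filter (G.Adj x)).card : ℝ)) :
    ∃ S ⊆ Q, S.card = a ∧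
      η / 16 * Y.card ≤ ((Y.filter fun y => ∀ x ∈ S, G.Adj x y).card : ℝ) := by
  set m : α → ℕ := fun y => (Q.filter fun x => G.Adj x y).card with hm
  have hdc : ∑ x ∈ Q, (Y.filter (G.Adj x)).card = ∑ y ∈ Y, m y := by
    simp only [hm, Finset.card_filter]
    exact Finset.sum_comm
  have hlow : ((a : ℝ) - 1 + 4 * η) * Y.card ≤ ∑ y ∈ Y, (m y : ℝ) := by
    have h1 := Finset.sum_le_sum h
    rw [Finset.sum_const, hQ, nsmul_eq_mul] at h1
    have h2 : ∑ x ∈ Q, ((Y.filter (G.Adj x)).card : ℝ) = ∑ y ∈ Y, (m y : ℝ) := by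
      exact_mod_cast hdc
    rw [h2] at h1
    push_cast at h1
    linarith
  -- A vertex with fewer than `a` neighbours in `Q` counts at most `a - 1`, any other at most 4; so
  -- at least `η * Y.card` vertices see `a` elements of `Q`.
  have hup : ∑ y ∈ Y, (m y : ℝ) ≤
      ((a : ℝ) - 1) * Y.card + 4 * (Y.filter fun y => a ≤ m y).card := by
    have h1 : ∀ y ∈ Y, (m y : ℝ) ≤ ((a : ℝ) - 1) + 4 * (if a ≤ m y then 1 else 0) := by
      intro y _
      have h4 : m y ≤ 4 := hQ ▸ Finset.card_filter_le _ _
      have h4' : (m y : ℝ) ≤ 4 := by exact_mod_cast h4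
      have ha' : (1 : ℝ) ≤ a := by exact_mod_cast ha
      split_ifs with hc
      · linarith
      · have : (m y : ℝ) + 1 ≤ a := by exact_mod_cast (by omega : m y + 1 ≤ a)
        linarith
    refine (Finset.sum_le_sum h1).trans (le_of_eq ?_)
    rw [Finset.sum_add_distrib, Finset.sum_const, ← Finset.mul_sum, nsmul_eq_mul,
      Finset.card_filter]
    push_cast
    ring
  have hcov : Y.filter (fun y => a ≤ m y) ⊆
      (Q.powersetCard a).biUnion fun S => Y.filter fun y => ∀ x ∈ S, G.Adj x y := by
    intro y hy
    obtain ⟨hy, hay⟩ := Finset.mem_filter.1 hy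
    obtain ⟨S, hS, hSa⟩ := Finset.exists_subset_card_eq hay
    simp only [Finset.mem_biUnion, Finset.mem_powersetCard, Finset.mem_filter]
    exact ⟨S, ⟨hS.trans (Finset.filter_subset _ _), hSa⟩, hy,
      fun x hx => (Finset.mem_filter.1 (hS hx)).2⟩
  by_contra! hc
  have hne : (Q.powersetCard a).Nonempty := Finset.powersetCard_nonempty.2 (hQ ▸ ha4)
  have hsum : ((Y.filter fun y => a ≤ m y).card : ℝ) <
      (Q.powersetCard a).card * (η / 16 * Y.card) := by
    calc _ ≤ ((∑ S ∈ Q.powersetCard a,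
          (Y.filter fun y => ∀ x ∈ S, G.Adj x y).card : ℕ) : ℝ) := by
            exact_mod_cast (Finset.card_le_card hcov).trans Finset.card_biUnion_le
      _ < ∑ S ∈ Q.powersetCard a, η / 16 * (Y.card : ℝ) := by
            push_cast
            refine Finset.sum_lt_sum_of_nonempty hne fun S hS => ?_
            rw [Finset.mem_powersetCard] at hS
            exact hc S hS.1 hS.2
      _ = _ := by rw [Finset.sum_const, nsmul_eq_mul]
  -- Pigeonhole over at most 2 ^ 4 subsets of `Q` costs the factor 16 in `η / 16`.
  have h16 : ((Q.powersetCard a).card : ℝ) ≤ 16 := by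
    rw [Finset.card_powersetCard, hQ]
    exact_mod_cast Nat.choose_le_two_pow 4 a
  have h0 : 0 ≤ η / 16 * (Y.card : ℝ) := by positivity
  nlinarith

/-- The embedding lemma: in hereditarily dense clusters all of whose large subsets contain a
`4`-clique, every clique predicted by the weights occurs. -/
theorem Emb.exists_isNClique {ι : Type*} [DecidableEq ι] {w : ι → ι → ℕ} {V : ι → Finset α}
    {η s : ℝ} (hη : 0 < η) (hη1 : η ≤ 1) (hs : 0 < s)
    (hK4 : ∀ X : Finset α, s ≤ X.card → ∃ Q ⊆ X, G.IsNClique 4 Q)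
    (hdense : ∀ i j, i ≠ j → 1 ≤ w i j →
      HereditarilyDense G s (((w i j : ℝ) - 1) / 4 + η) (V i) (V j))
    {I : Finset ι} {K : ℕ} (hI : Emb w I K) :
    ∀ U : ι → Finset α, (∀ i ∈ I, U i ⊆ V i) →
      (∀ i ∈ I, (16 / η) ^ I.card * s ≤ (U i).card) →
      ∃ T, G.IsNClique K T ∧ ∀ t ∈ T, ∃ i ∈ I, t ∈ U i := by
  have hC : 16 ≤ 16 / η := by rw [le_div_iff₀ hη]; linarith
  induction hI with
  | base i =>
    intro U _ hU
    have h1 := hU i (by simp)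
    rw [Finset.card_singleton, pow_one] at h1
    obtain ⟨Q, hQ, hQ4⟩ := hK4 (U i) (by nlinarith)
    exact ⟨Q, hQ4, fun t ht => ⟨i, by simp, hQ ht⟩⟩
  | step i j₀ I K a hi hj₀ ha ha4 haw h hK ih =>
    intro U hUV hU
    rw [Finset.card_insert_of_notMem hi] at hU
    have hw : ∀ j ∈ I, 1 ≤ w i j := by
      intro j hj
      by_cases hjj : j = j₀
      · subst hjj; omega
      · have := h j hj hjj
        by_contra hc
        have h0 : w i j = 0 := by omega
        rw [h0] at this
        omega
    have hne : ∀ j ∈ I, i ≠ j := fun j hj hij => hi (hij ▸ hj)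
    set τ : ι → ℝ := fun j => ((w i j : ℝ) - 1) / 4 + η with hτ
    set C : ℝ := 16 / η with hCdef
    have hpow : ∀ k : ℕ, (1 : ℝ) ≤ C ^ k := fun k => one_le_pow₀ (by linarith)
    have hsU : ∀ j ∈ insert i I, s ≤ (U j).card := fun j hj => by
      have := hU j hj
      have := hpow (I.card + 1)
      nlinarith
    set low : ι → Finset α := fun j =>
      (U i).filter fun x => (((U j).filter (G.Adj x)).card : ℝ) ≤ τ j * (U j).card with hlow
    have hlowlt : ∀ j ∈ I, ((low j).card : ℝ) < s := fun j hj =>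
      (hdense i j (hne j hj) (hw j hj)).card_low_degree_lt (hUV i (by simp))
        (hUV j (by simp [hj])) (hsU j (by simp [hj]))
    -- The 4-clique is taken among vertices of typical degree to every remaining cluster. Fewer than
    -- `s` vertices are lost per cluster, and `U i` has at least `(I.card + 1) * s`.
    obtain ⟨Q, hQ, hQ4⟩ := hK4 (U i \ I.biUnion low) (by
      have h1 : ((I.biUnion low).card : ℝ) ≤ I.card * s := by
        calc ((I.biUnion low).card : ℝ) ≤ ((∑ j ∈ I, (low j).card : ℕ) : ℝ) := by
              exact_mod_cast Finset.card_biUnion_le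
          _ ≤ ∑ j ∈ I, s := by
              push_cast
              exact Finset.sum_le_sum fun j hj => (hlowlt j hj).le
          _ = _ := by rw [Finset.sum_const, nsmul_eq_mul]
      have h2 : ((U i).card : ℝ) ≤ (U i \ I.biUnion low).card + (I.biUnion low).card := by
        have := Finset.le_card_sdiff (I.biUnion low) (U i)
        exact_mod_cast (by omega)
      have h3 := hU i (by simp)
      have h4 : (I.card : ℝ) + 1 ≤ C ^ (I.card + 1) := by
        have h5 : I.card + 1 < 16 ^ (I.card + 1) := Nat.lt_pow_self (by norm_num)
        have h6 : (16 : ℝ) ^ (I.card + 1) ≤ C ^ (I.card + 1) :=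
          pow_le_pow_left₀ (by norm_num) hC _
        have h7 : ((I.card : ℝ) + 1) ≤ 16 ^ (I.card + 1) := by exact_mod_cast h5.le
        linarith
      nlinarith)
    have hdeg : ∀ x ∈ Q, ∀ j ∈ I, τ j * (U j).card ≤ (((U j).filter (G.Adj x)).card : ℝ) := by
      intro x hx j hj
      have h1 := hQ hx
      simp only [Finset.mem_sdiff, Finset.mem_biUnion, not_exists, not_and, hlow,
        Finset.mem_filter, not_le] at h1
      exact (h1.2 j hj h1.1).le
    obtain ⟨S, hSQ, hSa, hSj₀⟩ := exists_subset_card_common_nbhd_ge G (Y := U j₀) (η := η)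
      hQ4.card_eq ha ha4 hη.le (by
        intro x hx
        refine le_trans ?_ (hdeg x hx j₀ hj₀)
        have : (a : ℝ) ≤ w i j₀ := by exact_mod_cast haw
        simp only [hτ]
        gcongr)
    set U' : ι → Finset α := fun j => (U j).filter fun y => ∀ x ∈ S, G.Adj x y with hU'
    have hlarge : ∀ j ∈ I, η / 16 * (U j).card ≤ ((U' j).card : ℝ) := by
      intro j hj
      by_cases hjj : j = j₀
      · subst hjj; exact hSj₀
      · refine card_common_nbhd_ge G (τ := τ j) (fun x hx => hdeg x (hSQ hx) j hj) ?_
        -- This reads a(1 - (w - 1)/4) ≤ 1. Each vertex of `S` misses at most a fraction 1 - (w -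
        -- 1)/4 - η, so together they leave at least aη ≥ η/16.
        have h1 : (5 * a : ℝ) ≤ a * w i j + 4 := by exact_mod_cast h j hj hjj
        have h2 : (1 : ℝ) ≤ a := by exact_mod_cast ha
        rw [hSa, hτ]
        nlinarith
    obtain ⟨T, hT, hTU⟩ := ih U'
      (fun j hj => (Finset.filter_subset _ _).trans (hUV j (by simp [hj])))
      (fun j hj => by
        refine le_trans ?_ (hlarge j hj)
        have h1 := hU j (by simp [hj])
        have h2 : η / 16 * C = 1 := by rw [hCdef]; field_simp
        calc C ^ I.card * s = (η / 16 * C) * (C ^ I.card * s) := by rw [h2, one_mul]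
          _ = η / 16 * (C ^ (I.card + 1) * s) := by ring
          _ ≤ _ := by gcongr)
    have hadj : ∀ x ∈ S, ∀ t ∈ T, G.Adj x t := by
      intro x hx t ht
      obtain ⟨j, _, htj⟩ := hTU t ht
      exact (Finset.mem_filter.1 htj).2 x hx
    refine ⟨T ∪ S, ⟨?_, ?_⟩, ?_⟩
    · have hSc : G.IsClique (S : Set α) := hQ4.isClique.subset (by exact_mod_cast hSQ)
      rw [Finset.coe_union]
      rintro x (hx | hx) y (hy | hy) hxy
      · exact hT.isClique hx hy hxy
      · exact (hadj y hy x hx).symm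
      · exact hadj x hx y hy
      · exact hSc hx hy hxy
    · rw [Finset.card_union_of_disjoint, hT.card_eq, hSa]
      rw [Finset.disjoint_right]
      exact fun x hx hxT => G.loopless.irrefl x (hadj x hx x hxT)
    · intro t ht
      rcases Finset.mem_union.1 ht with ht | ht
      · obtain ⟨j, hj, htj⟩ := hTU t ht
        exact ⟨j, by simp [hj], (Finset.mem_filter.1 htj).1⟩
      · exact ⟨i, by simp, (Finset.mem_sdiff.1 (hQ (hSQ ht))).1⟩

end Clusters

/-! ### Cliques forced by small weight patterns. -/

section Weights

variable {ι : Type*} [DecidableEq ι] {w : ι → ι → ℕ}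

/-- Retaining a single vertex only requires positive weights, since 5 ≤ w + 4; every additional
cluster thus contributes one vertex. -/
lemma Emb.extend {I S : Finset ι} {K : ℕ} (h : Emb w I K) (hIS : I ⊆ S)
    (hS : ∀ i ∈ S, ∀ j ∈ S, i ≠ j → 1 ≤ w i j) : Emb w S (K + (S.card - I.card)) := by
  have hIne : I.Nonempty := by cases h <;> simp
  obtain ⟨j₀, hj₀⟩ := hIne
  suffices H : ∀ T : Finset ι, T ⊆ S → Disjoint T I → Emb w (T ∪ I) (K + T.card) by
    have h1 := H (S \ I) Finset.sdiff_subset Finset.sdiff_disjoint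
    rwa [Finset.sdiff_union_of_subset hIS, Finset.card_sdiff_of_subset hIS] at h1
  intro T
  induction T using Finset.induction_on with
  | empty => intro _ _; simpa using h
  | insert i T hi ih =>
    intro hTS hd
    rw [Finset.disjoint_insert_left] at hd
    rw [Finset.insert_union, Finset.card_insert_of_notMem hi, ← add_assoc]
    have hiU : i ∉ T ∪ I := by simp [hi, hd.1]
    have hw : ∀ j ∈ T ∪ I, 1 ≤ w i j := fun j hj => hS i (hTS (by simp)) j
      ((Finset.mem_union.1 hj).elim (fun h => hTS (by simp [h])) (fun h => hIS h))
      (fun hij => hiU (hij ▸ hj))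
    exact Emb.step i j₀ _ _ 1 hiU (by simp [hj₀]) le_rfl (by norm_num) (hw j₀ (by simp [hj₀]))
      (fun j hj _ => by have := hw j hj; omega) (ih ((Finset.subset_insert _ _).trans hTS) hd.2)

lemma Emb.pair {i j : ι} (hij : i ≠ j) {a : ℕ} (ha : 1 ≤ a) (ha4 : a ≤ 4) (h : a ≤ w i j) :
    Emb w {i, j} (4 + a) :=
  Emb.step i j {j} 4 a (by simpa using hij) (by simp) ha ha4 h
    (fun k hk hkj => absurd (Finset.mem_singleton.1 hk) hkj) (Emb.base j)

/-- The clique found in a triangle when `a` vertices are retained in the first cluster. -/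
lemma Emb.triple {i j k : ι} (hij : i ≠ j) (hik : i ≠ k) (hjk : j ≠ k) {a b : ℕ} (ha : 1 ≤ a)
    (ha4 : a ≤ 4) (hb : 1 ≤ b) (hb4 : b ≤ 4) (h : a ≤ w i j) (h' : 5 * a ≤ a * w i k + 4)
    (hw : b ≤ w j k) : Emb w {i, j, k} (4 + b + a) := by
  refine Emb.step i j {j, k} _ a (by simp [hij, hik]) (by simp) ha ha4 h ?_ (Emb.pair hjk hb hb4 hw)
  intro l hl hlj
  rw [Finset.mem_insert, Finset.mem_singleton] at hl
  rcases hl with rfl | rfl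
  · exact absurd rfl hlj
  · exact h'

/-- Four clusters, in the first two of which two vertices are retained. -/
lemma Emb.quadruple {i j k l : ι} (hij : i ≠ j) (hik : i ≠ k) (hil : i ≠ l) (hjk : j ≠ k)
    (hjl : j ≠ l) (hkl : k ≠ l) (h1 : (2 ≤ w i j ∧ 3 ≤ w i k ∧ 3 ≤ w i l) ∨
      (3 ≤ w i j ∧ 2 ≤ w i k ∧ 3 ≤ w i l) ∨ (3 ≤ w i j ∧ 3 ≤ w i k ∧ 2 ≤ w i l))
    (h2 : 2 ≤ w j k) (h2' : 3 ≤ w j l) (h3 : 4 ≤ w k l) : Emb w {i, j, k, l} 12 := by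
  have h := Emb.triple (w := w) hjk hjl hkl (a := 2) (b := 4) (by norm_num) (by norm_num)
    (by norm_num) (by norm_num) h2 (by omega) h3
  have hi : i ∉ ({j, k, l} : Finset ι) := by simp [hij, hik, hil]
  rcases h1 with h1 | h1 | h1
  · refine Emb.step i j _ _ 2 hi (by simp) (by norm_num) (by norm_num) h1.1 ?_ h
    intro m hm hmj
    simp only [Finset.mem_insert, Finset.mem_singleton] at hm
    rcases hm with rfl | rfl | rfl <;> first | exact absurd rfl hmj | omega
  · refine Emb.step i k _ _ 2 hi (by simp) (by norm_num) (by norm_num) h1.2.1 ?_ h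
    intro m hm hmj
    simp only [Finset.mem_insert, Finset.mem_singleton] at hm
    rcases hm with rfl | rfl | rfl <;> first | exact absurd rfl hmj | omega
  · refine Emb.step i l _ _ 2 hi (by simp) (by norm_num) (by norm_num) h1.2.2 ?_ h
    intro m hm hmj
    simp only [Finset.mem_insert, Finset.mem_singleton] at hm
    rcases hm with rfl | rfl | rfl <;> first | exact absurd rfl hmj | omega

end Weights

/-! ### The Lagrangian of a weight function. -/

section Lagrangian

variable {ι : Type*} [Fintype ι] [DecidableEq ι]

/-- The quadratic form of a weight function. -/
def quadForm (w : ι → ι → ℕ) (x : ι → ℝ) : ℝ := ∑ i, ∑ j, (w i j : ℝ) * x i * x j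

/-- Moving mass t from `v` to `u` is a Taylor expansion; as the diagonal vanishes, the second-order
term involves only the weight of the pair. -/
lemma quadForm_shift {w : ι → ι → ℕ} (hsymm : ∀ i j, w i j = w j i) (hdiag : ∀ i, w i i = 0)
    (x : ι → ℝ) (u v : ι) (t : ℝ) :
    quadForm w (x + t • (Pi.single u 1 - Pi.single v 1)) = quadForm w x +
      2 * t * (∑ j, (w u j : ℝ) * x j - ∑ j, (w v j : ℝ) * x j) - 2 * t ^ 2 * w u v := by
  set e : ι → ℝ := Pi.single u 1 - Pi.single v 1 with he
  have hexp : quadForm w (x + t • e) = quadForm w x + t * (∑ i, ∑ j, (w i j : ℝ) * e i * x j) +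
      t * (∑ i, ∑ j, (w i j : ℝ) * x i * e j) + t ^ 2 * quadForm w e := by
    simp only [quadForm, Finset.mul_sum, ← Finset.sum_add_distrib]
    refine Finset.sum_congr rfl fun i _ => Finset.sum_congr rfl fun j _ => ?_
    simp only [Pi.add_apply, Pi.smul_apply, smul_eq_mul]
    ring
  have hlin : ∀ f : ι → ℝ, ∑ i, f i * e i = f u - f v := by
    intro f
    simp [he, mul_sub, Finset.sum_sub_distrib, Pi.single_apply]
  have h1 : ∑ i, ∑ j, (w i j : ℝ) * e i * x j =
      ∑ j, (w u j : ℝ) * x j - ∑ j, (w v j : ℝ) * x j := by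
    rw [← hlin fun i => ∑ j, (w i j : ℝ) * x j]
    refine Finset.sum_congr rfl fun i _ => ?_
    rw [Finset.sum_mul]
    exact Finset.sum_congr rfl fun j _ => by ring
  have h2 : ∑ i, ∑ j, (w i j : ℝ) * x i * e j = ∑ i, ∑ j, (w i j : ℝ) * e i * x j := by
    rw [Finset.sum_comm]
    refine Finset.sum_congr rfl fun i _ => Finset.sum_congr rfl fun j _ => ?_
    rw [hsymm]
    ring
  have h3 : quadForm w e = -2 * w u v := by
    have : ∀ i, ∑ j, (w i j : ℝ) * e i * e j = ((w i u : ℝ) - w i v) * e i := by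
      intro i
      rw [hlin fun j => (w i j : ℝ) * e i]
      ring
    rw [quadForm, Finset.sum_congr rfl fun i _ => this i, hlin, hdiag, hdiag, hsymm v u]
    push_cast
    ring
  rw [hexp, h2, h1, h3]
  ring

lemma shift_mem_stdSimplex {x : ι → ℝ} (hx : x ∈ stdSimplex ℝ ι) {u v : ι} {t : ℝ}
    (hu : -x u ≤ t) (hv : t ≤ x v) (huv : u ≠ v) :
    x + t • (Pi.single u 1 - Pi.single v 1) ∈ stdSimplex ℝ ι := by
  refine ⟨fun i => ?_, ?_⟩
  · have := hx.1 i
    by_cases hiu : i = u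
    · subst hiu
      simp [huv]
      linarith
    · by_cases hiv : i = v
      · subst hiv
        simp [hiu]
        linarith
      · simpa [hiu, hiv] using this
  · simp [Finset.sum_add_distrib, hx.2, ← Finset.mul_sum]

/-- A maximizer of the quadratic form on the simplex can be chosen so that its support is a clique
of positive weights, on which the partial derivatives agree. -/
theorem exists_maximizer_clique [Nonempty ι] {w : ι → ι → ℕ} (hsymm : ∀ i j, w i j = w j i)
    (hdiag : ∀ i, w i i = 0) :
    ∃ x ∈ stdSimplex ℝ ι, (∀ y ∈ stdSimplex ℝ ι, quadForm w y ≤ quadForm w x) ∧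
      (∀ u v, x u ≠ 0 → x v ≠ 0 → u ≠ v → 1 ≤ w u v) ∧
      (∀ u, x u ≠ 0 → ∑ j, (w u j : ℝ) * x j = quadForm w x) := by
  classical
  have hcont : Continuous (quadForm w) := by unfold quadForm; fun_prop
  have hne : (stdSimplex ℝ ι).Nonempty := ⟨_, single_mem_stdSimplex ℝ (Classical.arbitrary ι)⟩
  obtain ⟨x₀, hx₀, hmax₀⟩ := (isCompact_stdSimplex (𝕜 := ℝ) ι).exists_isMaxOn hne hcont.continuousOn
  -- Among the maximizers, one of least support is selected.
  let P : ℕ → Prop := fun n => ∃ x ∈ stdSimplex ℝ ι,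
    (∀ y ∈ stdSimplex ℝ ι, quadForm w y ≤ quadForm w x) ∧
      (Finset.univ.filter fun i => x i ≠ 0).card = n
  have hP : ∃ n, P n := ⟨_, x₀, hx₀, fun y hy => hmax₀ hy, rfl⟩
  obtain ⟨x, hx, hmax, hcard⟩ := Nat.find_spec hP
  have hpos : ∀ u, x u ≠ 0 → 0 < x u := fun u hu => lt_of_le_of_ne (hx.1 u) (Ne.symm hu)
  set g : ι → ℝ := fun u => ∑ j, (w u j : ℝ) * x j with hg
  have hgle : ∀ u v, x u ≠ 0 → x v ≠ 0 → g u ≤ g v := by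
    intro u v hu hv
    by_contra! hlt
    have huv : u ≠ v := by rintro rfl; exact lt_irrefl _ hlt
    -- So small that the linear gain beats the loss 2t²w, while the mass of `v` stays nonnegative.
    set t := min (x v) ((g u - g v) / (2 * (w u v + 1))) with ht
    have htpos : 0 < t := lt_min (hpos v hv) (by have := sub_pos.2 hlt; positivity)
    have h1 := hmax _ (shift_mem_stdSimplex hx (u := u) (v := v) (t := t)
      (by have := hx.1 u; linarith) (min_le_left _ _) huv)
    rw [quadForm_shift hsymm hdiag] at h1
    have h2 : t * (2 * (w u v + 1)) ≤ g u - g v := by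
      rw [← le_div_iff₀ (by positivity)]
      exact min_le_right _ _
    have h3 : (0 : ℝ) ≤ w u v := by positivity
    change quadForm w x + 2 * t * (g u - g v) - _ ≤ _ at h1
    nlinarith
  have hgeq : ∀ u v, x u ≠ 0 → x v ≠ 0 → g u = g v := fun u v hu hv =>
    le_antisymm (hgle u v hu hv) (hgle v u hv hu)
  refine ⟨x, hx, hmax, ?_, ?_⟩
  · intro u v hu hv huv
    by_contra hw
    have hw0 : w u v = 0 := by omega
    -- With weight 0 and equal derivatives, moving all the mass of `v` to `u` keeps the value and
    -- shrinks the support, against minimality.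
    set y := x + x v • ((Pi.single u 1 : ι → ℝ) - Pi.single v 1) with hy
    have hyQ : quadForm w y = quadForm w x := by
      rw [hy, quadForm_shift hsymm hdiag, hw0]
      change quadForm w x + 2 * x v * (g u - g v) - _ = _
      rw [hgeq u v hu hv]
      push_cast
      ring
    have hymem : y ∈ stdSimplex ℝ ι := shift_mem_stdSimplex hx
      (by have := hx.1 u; have := hx.1 v; linarith) le_rfl huv
    refine Nat.find_min hP (m := (Finset.univ.filter fun i => y i ≠ 0).card) ?_
      ⟨y, hymem, fun z hz => hyQ ▸ hmax z hz, rfl⟩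
    rw [← hcard]
    refine Finset.card_lt_card (Finset.ssubset_iff_of_subset ?_ |>.2 ⟨v, ?_, ?_⟩)
    · intro i hi
      simp only [Finset.mem_filter, Finset.mem_univ, true_and] at hi ⊢
      intro hi0
      by_cases hiu : i = u
      · exact hu (hiu ▸ hi0)
      · by_cases hiv : i = v
        · exact hv (hiv ▸ hi0)
        · exact hi (by simp [hy, hi0, hiu, hiv])
    · simpa using hv
    · simp [hy, huv.symm]
  · intro u hu
    have h1 : quadForm w x = ∑ i, x i * g i := by
      simp only [quadForm, hg, Finset.mul_sum]
      exact Finset.sum_congr rfl fun i _ => Finset.sum_congr rfl fun j _ => by ring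
    have h2 : ∑ i, x i * g i = ∑ i, x i * g u := by
      refine Finset.sum_congr rfl fun i _ => ?_
      by_cases hi : x i = 0
      · simp [hi]
      · rw [hgeq i u hi hu]
    rw [h1, h2, ← Finset.sum_mul, hx.2, one_mul]

end Lagrangian

/-! ### The bound 32/13 on cliques of positive weights. -/

set_option synthInstance.maxSize 2000 in
set_option synthInstance.maxHeartbeats 400000 in
/-- For each admissible weighting of a `4`-clique with an edge of weight `4`, one of six convex
combinations of the rows of the weight matrix has small entries. -/
lemma exists_combination_aux : ∀ a ∈ Finset.Icc (1 : ℕ) 4, ∀ b ∈ Finset.Icc 1 4, ∀ c ∈ Finset.Icc 1 4,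
    ∀ d ∈ Finset.Icc 1 4, ∀ e ∈ Finset.Icc 1 4,
    (c = 4 → a ≤ 2) → (d = 4 → b ≤ 2) → (a = 4 → c ≤ 2) → (b = 4 → d ≤ 2) →
    (b = 4 → e = 4 → a ≤ 2) → (d = 4 → e = 4 → c ≤ 2) → (a = 4 → e = 4 → b ≤ 2) →
    (c = 4 → e = 4 → d ≤ 2) → (a = 4 → b = 4 → e ≤ 2) → (c = 4 → d = 4 → e ≤ 2) →
    (((2 ≤ b ∧ 3 ≤ d) ∨ (2 ≤ d ∧ 3 ≤ b)) →
      ¬ ((2 ≤ e ∧ 3 ≤ a ∧ 3 ≤ c) ∨ (3 ≤ e ∧ 2 ≤ a ∧ 3 ≤ c) ∨ (3 ≤ e ∧ 3 ≤ a ∧ 2 ≤ c))) →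
    ((a + 2 * b ≤ 10 ∧ c + 2 * d ≤ 10 ∧ 3 * a + 3 * c + 2 * e ≤ 22 ∧ 3 * b + 3 * d + e ≤ 22) ∨
    (2 * a + b ≤ 10 ∧ 2 * c + d ≤ 10 ∧ 3 * a + 3 * c + e ≤ 22 ∧ 3 * b + 3 * d + 2 * e ≤ 22) ∨
    (a + b ≤ 5 ∧ c + d ≤ 7 ∧ 2 * a + 3 * c + 2 * e ≤ 22 ∧ 2 * b + 3 * d + 2 * e ≤ 22) ∨
    (a + b ≤ 7 ∧ c + d ≤ 5 ∧ 3 * a + 2 * c + 2 * e ≤ 22 ∧ 3 * b + 2 * d + 2 * e ≤ 22) ∨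
    (a + b ≤ 4 ∧ a + 2 * c + e ≤ 12 ∧ b + 2 * d + e ≤ 12) ∨
    (c + d ≤ 4 ∧ 2 * a + c + e ≤ 12 ∧ 2 * b + d + e ≤ 12 : Prop)) := by
  decide +kernel

section Clique

variable {ι : Type*} [DecidableEq ι] {w : ι → ι → ℕ} {S : Finset ι} {x : ι → ℝ} {lam : ℝ}

lemma card_mul_le_of_weight_le (hdiag : ∀ i, w i i = 0) (hpos : ∀ i ∈ S, 0 < x i)
    (hsum : ∑ i ∈ S, x i = 1) (hlam : ∀ u ∈ S, ∑ j ∈ S, (w u j : ℝ) * x j = lam) (c : ℕ)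
    (hc : ∀ i ∈ S, ∀ j ∈ S, i ≠ j → w i j ≤ c) : S.card * lam ≤ c * (S.card - 1) := by
  have h : ∀ u ∈ S, lam ≤ c * (1 - x u) := by
    intro u hu
    rw [← hlam u hu, ← hsum, ← Finset.add_sum_erase S _ hu, ← Finset.add_sum_erase S x hu, hdiag]
    simp only [Nat.cast_zero, zero_mul, zero_add, add_sub_cancel_left, Finset.mul_sum]
    refine Finset.sum_le_sum fun j hj => ?_
    have hj' := Finset.mem_erase.1 hj
    have h1 : (w u j : ℝ) ≤ c := by exact_mod_cast hc u hu j hj'.2 hj'.1.symm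
    exact mul_le_mul_of_nonneg_right h1 (hpos j hj'.2).le
  have h2 := Finset.sum_le_sum h
  rw [Finset.sum_const, nsmul_eq_mul, ← Finset.mul_sum, Finset.sum_sub_distrib, hsum,
    Finset.sum_const, nsmul_eq_mul, mul_one] at h2
  exact h2

/-- The sum of the derivative equations at `u` and `v`: a heavy pair whose joint weights to other
clusters are small forces `lam` to be small. -/
lemma two_mul_eq_of_pair (hsymm : ∀ i j, w i j = w j i) (hdiag : ∀ i, w i i = 0)
    (hlam : ∀ u ∈ S, ∑ j ∈ S, (w u j : ℝ) * x j = lam) {u v : ι} (hu : u ∈ S) (hv : v ∈ S)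
    (huv : u ≠ v) : 2 * lam = w u v * (x u + x v) +
      ∑ z ∈ (S.erase u).erase v, ((w u z + w v z : ℕ) : ℝ) * x z := by
  have hv' : v ∈ S.erase u := Finset.mem_erase.2 ⟨huv.symm, hv⟩
  have h1 := hlam u hu
  have h2 := hlam v hv
  rw [← Finset.add_sum_erase S _ hu, ← Finset.add_sum_erase _ _ hv', hdiag] at h1 h2
  simp only [Nat.cast_add, add_mul, Finset.sum_add_distrib, hsymm v u] at h1 h2 ⊢
  push_cast at h1 h2
  linarith

lemma sum_erase_erase_eq (hsum : ∑ i ∈ S, x i = 1) {u v : ι} (hu : u ∈ S) (hv : v ∈ S)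
    (huv : u ≠ v) : ∑ z ∈ (S.erase u).erase v, x z = 1 - (x u + x v) := by
  have hv' : v ∈ S.erase u := Finset.mem_erase.2 ⟨huv.symm, hv⟩
  rw [← hsum, ← Finset.add_sum_erase S x hu, ← Finset.add_sum_erase _ x hv']
  ring

/-- The weighted Turán bound on a clique of positive weights. -/
theorem le_of_clique (hsymm : ∀ i j, w i j = w j i) (hdiag : ∀ i, w i i = 0)
    (hle : ∀ i j, w i j ≤ 4) (hfree : ∀ I K, I.card ≤ 9 → Emb w I K → K ≤ 11)
    (hpos : ∀ i ∈ S, 0 < x i) (hsum : ∑ i ∈ S, x i = 1)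
    (hcl : ∀ i ∈ S, ∀ j ∈ S, i ≠ j → 1 ≤ w i j)
    (hlam : ∀ u ∈ S, ∑ j ∈ S, (w u j : ℝ) * x j = lam) : lam ≤ 32 / 13 := by
  have hSne : S.Nonempty := by
    rw [Finset.nonempty_iff_ne_empty]
    rintro rfl
    simp at hsum
  have hS8 : S.card ≤ 8 := by
    by_contra! hc
    -- Nine clusters already give 4 + 8 = 12 vertices.
    obtain ⟨T, hTS, hT⟩ := Finset.exists_subset_card_eq (show 9 ≤ S.card by omega)
    obtain ⟨i, hi⟩ : T.Nonempty := Finset.card_pos.1 (by omega)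
    have h1 := (Emb.base (w := w) i).extend (S := T) (by simpa using hi)
      (fun j hj k hk => hcl j (hTS hj) k (hTS hk))
    have h2 := hfree T _ (by omega) h1
    rw [hT, Finset.card_singleton] at h2
    omega
  have hS0 : 1 ≤ S.card := hSne.card_pos
  have hR : ∀ I K, I ⊆ S → Emb w I K → K + (S.card - I.card) ≤ 11 := fun I K hIS hI =>
    hfree S _ (by omega) (hI.extend hIS hcl)
  have havg := card_mul_le_of_weight_le hdiag hpos hsum hlam
  have hpair : 2 ≤ S.card → ∀ i ∈ S, ∀ j ∈ S, i ≠ j → w i j + S.card ≤ 9 := by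
    intro h2 i hi j hj hij
    have h1 := hR {i, j} _ (by simp [Finset.insert_subset_iff, hi, hj])
      (Emb.pair hij (hcl i hi j hj hij) (hle i j) le_rfl)
    rw [Finset.card_pair hij] at h1
    omega
  have htri : ∀ z ∈ S, ∀ u ∈ S, ∀ v ∈ S, z ≠ u → z ≠ v → u ≠ v → 2 ≤ w z u → 3 ≤ w z v →
      w u v + 6 + (S.card - 3) ≤ 11 := by
    intro z hz u hu v hv hzu hzv huv h2 h3
    have h1 := hR {z, u, v} _ (by simp [Finset.insert_subset_iff, hu, hv, hz])
      (Emb.triple hzu hzv huv (a := 2) (by norm_num) (by norm_num) (hcl u hu v hv huv)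
        (hle u v) h2 (by omega) le_rfl)
    rw [Finset.card_eq_three.2 ⟨z, u, v, hzu, hzv, huv, rfl⟩] at h1
    omega
  have hfull : ∀ z ∈ S, ∀ u ∈ S, ∀ v ∈ S, z ≠ u → z ≠ v → u ≠ v → w z u = 4 → w z v = 4 →
      w u v + 8 + (S.card - 3) ≤ 11 := by
    intro z hz u hu v hv hzu hzv huv h2 h3
    have h1 := hR {z, u, v} _ (by simp [Finset.insert_subset_iff, hu, hv, hz])
      (Emb.triple hzu hzv huv (a := 4) (by norm_num) (by norm_num) (hcl u hu v hv huv)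
        (hle u v) h2.ge (by omega) le_rfl)
    rw [Finset.card_eq_three.2 ⟨z, u, v, hzu, hzv, huv, rfl⟩] at h1
    omega
  by_contra! hgt
  have hlow : ∀ c : ℕ, (∀ i ∈ S, ∀ j ∈ S, i ≠ j → w i j ≤ c) →
      (c : ℝ) * (S.card - 1) < S.card * (32 / 13) → False := by
    intro c hc h
    have h1 := havg c hc
    have h2 : (1 : ℝ) ≤ S.card := by exact_mod_cast hS0
    nlinarith
  have hex : ∀ c : ℕ, (c : ℝ) * (S.card - 1) < S.card * (32 / 13) →
      ∃ u ∈ S, ∃ v ∈ S, u ≠ v ∧ c < w u v := by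
    intro c hc
    by_contra! hcon
    exact hlow c hcon hc
  have hmem : ∀ {u v z : ι}, z ∈ (S.erase u).erase v → z ∈ S ∧ z ≠ u ∧ z ≠ v := by
    intro u v z hz
    simp only [Finset.mem_erase] at hz
    exact ⟨hz.2.2, hz.2.1, hz.1⟩
  interval_cases hcard : S.card
  · exact hlow 4 (fun i _ j _ _ => hle i j) (by norm_num)
  · exact hlow 4 (fun i _ j _ _ => hle i j) (by norm_num)
  · obtain ⟨p, q, r, hpq, hpr, hqr, rfl⟩ := Finset.card_eq_three.1 hcard
    have hp := hlam p (by simp)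
    have hq := hlam q (by simp)
    have hr := hlam r (by simp)
    -- Three weights 4 would give 4 + 4 + 4 = 12. The critical weighting 4, 4, 3 attains 32/13 at
    -- (4, 4, 5)/13, with the 5 opposite the light edge.
    have h4 : ¬ (w p q = 4 ∧ w p r = 4 ∧ w q r = 4) := by
      rintro ⟨h1, h2, h3⟩
      have := hfull p (by simp) q (by simp) r (by simp) hpq hpr hqr h1 h2
      omega
    have hxp := hpos p (by simp)
    have hxq := hpos q (by simp)
    have hxr := hpos r (by simp)
    have hS : ∀ f : ι → ℝ, ∑ j ∈ {p, q, r}, f j = f p + f q + f r := fun f => by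
      rw [Finset.sum_insert (by simp [hpq, hpr]), Finset.sum_pair hqr, add_assoc]
    rw [hS] at hp hq hr hsum
    rw [hdiag] at hp hq hr
    rw [hsymm q p] at hq
    rw [hsymm r p, hsymm r q] at hr
    have hwpq : (w p q : ℝ) ≤ 4 := by exact_mod_cast hle p q
    have hwpr : (w p r : ℝ) ≤ 4 := by exact_mod_cast hle p r
    have hwqr : (w q r : ℝ) ≤ 4 := by exact_mod_cast hle q r
    have h1 := mul_le_mul_of_nonneg_right hwpq hxp.le
    have h2 := mul_le_mul_of_nonneg_right hwpq hxq.le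
    have h3 := mul_le_mul_of_nonneg_right hwpr hxp.le
    have h5 := mul_le_mul_of_nonneg_right hwpr hxr.le
    have h6 := mul_le_mul_of_nonneg_right hwqr hxq.le
    have h7 := mul_le_mul_of_nonneg_right hwqr hxr.le
    push_cast at hp hq hr
    have h8 : w p q ≤ 3 ∨ w p r ≤ 3 ∨ w q r ≤ 3 := by
      have := hle p q
      have := hle p r
      have := hle q r
      omega
    rcases h8 with h8 | h8 | h8
    · have h9 : (w p q : ℝ) ≤ 3 := by exact_mod_cast h8
      have := mul_le_mul_of_nonneg_right h9 hxp.le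
      have := mul_le_mul_of_nonneg_right h9 hxq.le
      linarith
    · have h9 : (w p r : ℝ) ≤ 3 := by exact_mod_cast h8
      have := mul_le_mul_of_nonneg_right h9 hxp.le
      have := mul_le_mul_of_nonneg_right h9 hxr.le
      linarith
    · have h9 : (w q r : ℝ) ≤ 3 := by exact_mod_cast h8
      have := mul_le_mul_of_nonneg_right h9 hxq.le
      have := mul_le_mul_of_nonneg_right h9 hxr.le
      linarith
  -- Weights at most 3 would give only 9/4 on four clusters, so there is an edge of weight 4.
  · obtain ⟨u, hu, v, hv, huv, huv3⟩ := hex 3 (by norm_num)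
    have hcard2 : ((S.erase u).erase v).card = 2 := by
      rw [Finset.card_erase_of_mem (Finset.mem_erase.2 ⟨huv.symm, hv⟩),
        Finset.card_erase_of_mem hu, hcard]
    obtain ⟨y, z, hyz, hyzS⟩ := Finset.card_eq_two.1 hcard2
    obtain ⟨hy, hyu, hyv⟩ := hmem (u := u) (v := v) (z := y) (by simp [hyzS])
    obtain ⟨hz, hzu, hzv⟩ := hmem (u := u) (v := v) (z := z) (by simp [hyzS])
    have hS : ∀ f : ι → ℝ, ∑ j ∈ S, f j = f u + f v + f y + f z := fun f => by
      rw [← Finset.add_sum_erase S f hu, ← Finset.add_sum_erase _ f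
        (Finset.mem_erase.2 ⟨huv.symm, hv⟩), hyzS, Finset.sum_pair hyz]
      ring
    have huv4 : w u v = 4 := by have := hle u v; omega
    have hquad : ∀ k l : ι, k ∈ S → l ∈ S → y ≠ k → y ≠ l → z ≠ k → z ≠ l → k ≠ l →
        w k l = 4 → 2 ≤ w z k → 3 ≤ w z l →
        ¬ ((2 ≤ w y z ∧ 3 ≤ w y k ∧ 3 ≤ w y l) ∨ (3 ≤ w y z ∧ 2 ≤ w y k ∧ 3 ≤ w y l) ∨
          (3 ≤ w y z ∧ 3 ≤ w y k ∧ 2 ≤ w y l)) := by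
      intro k l hk hl hyk hyl hzk hzl hkl h4 h2 h3 h
      have h5 := hR {y, z, k, l} _ (by simp [Finset.insert_subset_iff, hy, hz, hk, hl])
        (Emb.quadruple hyz hyk hyl hzk hzl hkl h h2 h3 h4.ge)
      omega
    have hthird : ∀ p ∈ S, ∀ q ∈ S, ∀ r ∈ S, p ≠ q → p ≠ r → q ≠ r → w p q = 4 → w p r = 4 →
        w q r ≤ 2 := by
      intro p hp q hq r hr hpq hpr hqr h1 h2
      have := hfull p hp q hq r hr hpq hpr hqr h1 h2
      omega
    have hbd : ∀ p ∈ S, ∀ q ∈ S, p ≠ q → w p q ∈ Finset.Icc 1 4 := fun p hp q hq hpq =>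
      Finset.mem_Icc.2 ⟨hcl p hp q hq hpq, hle p q⟩
    have hcomb := exists_combination_aux (w u y) (hbd u hu y hy hyu.symm) (w u z)
      (hbd u hu z hz hzu.symm) (w v y) (hbd v hv y hy hyv.symm) (w v z) (hbd v hv z hz hzv.symm)
      (w y z) (hbd y hy z hz hyz)
      (fun h => hthird v hv u hu y hy huv.symm hyv.symm hyu.symm (hsymm u v ▸ huv4) h)
      (fun h => hthird v hv u hu z hz huv.symm hzv.symm hzu.symm (hsymm u v ▸ huv4) h)
      (fun h => hthird u hu v hv y hy huv hyu.symm hyv.symm huv4 h)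
      (fun h => hthird u hu v hv z hz huv hzu.symm hzv.symm huv4 h)
      (fun h h' => hthird z hz u hu y hy hzu hyz.symm hyu.symm (hsymm u z ▸ h) (hsymm y z ▸ h'))
      (fun h h' => hthird z hz v hv y hy hzv hyz.symm hyv.symm (hsymm v z ▸ h) (hsymm y z ▸ h'))
      (fun h h' => hthird y hy u hu z hz hyu hyz hzu.symm (hsymm u y ▸ h) h')
      (fun h h' => hthird y hy v hv z hz hyv hyz hzv.symm (hsymm v y ▸ h) h')
      (fun h h' => hthird u hu y hy z hz hyu.symm hzu.symm hyz h h')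
      (fun h h' => hthird v hv y hy z hz hyv.symm hzv.symm hyz h h')
      (by
        rintro (⟨h1, h2⟩ | ⟨h1, h2⟩)
        · have := hquad u v hu hv hyu hyv hzu hzv huv huv4 (hsymm u z ▸ h1) (hsymm v z ▸ h2)
          rw [hsymm y u, hsymm y v] at this
          exact this
        · have := hquad v u hv hu hyv hyu hzv hzu huv.symm (hsymm u v ▸ huv4) (hsymm v z ▸ h1)
            (hsymm u z ▸ h2)
          rw [hsymm y u, hsymm y v] at this
          tauto)
    have hxu := hpos u hu
    have hxv := hpos v hv
    have hxy := hpos y hy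
    have hxz := hpos z hz
    have e1 := hlam u hu
    have e2 := hlam v hv
    have e3 := hlam y hy
    have e4 := hlam z hz
    rw [hS] at e1 e2 e3 e4 hsum
    rw [hdiag, huv4] at e1
    rw [hdiag, hsymm v u, huv4] at e2
    rw [hdiag, hsymm y u, hsymm y v] at e3
    rw [hdiag, hsymm z u, hsymm z v, hsymm z y] at e4
    push_cast at e1 e2 e3 e4
    have hmul : ∀ (m n : ℕ) (t : ℝ), 0 < t → m ≤ n → (m : ℝ) * t ≤ n * t :=
      fun m n t ht h => mul_le_mul_of_nonneg_right (by exact_mod_cast h) ht.le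
    -- The row multipliers in the order u, v, y, z are (3,3,1,2), (3,3,2,1), (2,3,2,2), (3,2,2,2),
    -- (1,2,1,1), (2,1,1,1). All column sums are at most 22 in the first four cases and 12 in the
    -- last two; both 22/9 and 12/5 are below 32/13.
    rcases hcomb with ⟨h1, h2, h3, h4⟩ | ⟨h1, h2, h3, h4⟩ | ⟨h1, h2, h3, h4⟩ | ⟨h1, h2, h3, h4⟩ |
      ⟨h1, h3, h4⟩ | ⟨h2, h3, h4⟩
    · have k1 := hmul _ _ _ hxu h1
      have k2 := hmul _ _ _ hxv h2
      have k3 := hmul _ _ _ hxy h3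
      have k4 := hmul _ _ _ hxz h4
      push_cast at k1 k2 k3 k4
      linarith
    · have k1 := hmul _ _ _ hxu h1
      have k2 := hmul _ _ _ hxv h2
      have k3 := hmul _ _ _ hxy h3
      have k4 := hmul _ _ _ hxz h4
      push_cast at k1 k2 k3 k4
      linarith
    · have k1 := hmul _ _ _ hxu h1
      have k2 := hmul _ _ _ hxv h2
      have k3 := hmul _ _ _ hxy h3
      have k4 := hmul _ _ _ hxz h4
      push_cast at k1 k2 k3 k4
      linarith
    · have k1 := hmul _ _ _ hxu h1
      have k2 := hmul _ _ _ hxv h2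
      have k3 := hmul _ _ _ hxy h3
      have k4 := hmul _ _ _ hxz h4
      push_cast at k1 k2 k3 k4
      linarith
    · have k1 := hmul _ _ _ hxu h1
      have k2 := hmul _ _ _ hxv (Nat.add_le_add (hle v y) (hle v z))
      have k3 := hmul _ _ _ hxy h3
      have k4 := hmul _ _ _ hxz h4
      push_cast at k1 k2 k3 k4
      linarith
    · have k2 := hmul _ _ _ hxv h2
      have k1 := hmul _ _ _ hxu (Nat.add_le_add (hle u y) (hle u z))
      have k3 := hmul _ _ _ hxy h3
      have k4 := hmul _ _ _ hxz h4
      push_cast at k1 k2 k3 k4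
      linarith
  · obtain ⟨u, hu, v, hv, huv, huv3⟩ := hex 3 (by norm_num)
    -- Across an edge of weight 4 the joint weights are at most 5, so 64/13 < 2 lam ≤ 5 - (x u + x
    -- v). Joint weight 5 must be 4 + 1, so such a `z` lies on another edge of weight 4 and also has
    -- mass below 1/13. Then 2 lam ≤ 4 + 3/13, a contradiction.
    have hsmall : ∀ u ∈ S, ∀ v ∈ S, u ≠ v → w u v = 4 →
        (∀ z ∈ (S.erase u).erase v, w u z + w v z ≤ 4 ∨
          (w u z + w v z = 5 ∧ (w u z = 4 ∨ w v z = 4))) ∧ x u + x v < 1 / 13 := by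
      intro u hu v hv huv h4
      have hz : ∀ z ∈ (S.erase u).erase v, w u z + w v z ≤ 4 ∨
          (w u z + w v z = 5 ∧ (w u z = 4 ∨ w v z = 4)) := by
        intro z hz
        obtain ⟨hzS, hzu, hzv⟩ := hmem hz
        have h1 := htri z hzS u hu v hv hzu hzv huv
        have h2 := htri z hzS v hv u hu hzv hzu huv.symm
        rw [hsymm z u, hsymm z v] at h1 h2
        rw [hsymm v u] at h2
        have := hle u z
        have := hle v z
        omega
      refine ⟨hz, ?_⟩
      have h1 := two_mul_eq_of_pair hsymm hdiag hlam hu hv huv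
      have h2 : ∑ z ∈ (S.erase u).erase v, ((w u z + w v z : ℕ) : ℝ) * x z ≤
          ∑ z ∈ (S.erase u).erase v, 5 * x z := by
        refine Finset.sum_le_sum fun z hz' => ?_
        have h3 : w u z + w v z ≤ 5 := by have := hz z hz'; omega
        exact mul_le_mul_of_nonneg_right (by exact_mod_cast h3) (hpos z (hmem hz').1).le
      rw [← Finset.mul_sum, sum_erase_erase_eq hsum hu hv huv] at h2
      rw [h4] at h1
      push_cast at h1 h2
      linarith
    have huv4 : w u v = 4 := by have := hle u v; omega
    have h0 := (hsmall u hu v hv huv huv4).1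
    have h1 := two_mul_eq_of_pair hsymm hdiag hlam hu hv huv
    have h2 : ∑ z ∈ (S.erase u).erase v, ((w u z + w v z : ℕ) : ℝ) * x z ≤
        ∑ z ∈ (S.erase u).erase v, (4 * x z + 1 / 13) := by
      refine Finset.sum_le_sum fun z hz => ?_
      obtain ⟨hzS, hzu, hzv⟩ := hmem hz
      have hxz := hpos z hzS
      rcases h0 z hz with h3 | ⟨h3, h4⟩
      · have := mul_le_mul_of_nonneg_right
          (show ((w u z + w v z : ℕ) : ℝ) ≤ 4 by exact_mod_cast h3) hxz.le
        linarith
      · have h5 : x z < 1 / 13 := by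
          rcases h4 with h4 | h4
          · have := (hsmall u hu z hzS hzu.symm h4).2
            have := hpos u hu
            linarith
          · have := (hsmall v hv z hzS hzv.symm h4).2
            have := hpos v hv
            linarith
        rw [h3]
        push_cast
        linarith
    rw [Finset.sum_add_distrib, ← Finset.mul_sum, sum_erase_erase_eq hsum hu hv huv,
      Finset.sum_const, Finset.card_erase_of_mem (Finset.mem_erase.2 ⟨huv.symm, hv⟩),
      Finset.card_erase_of_mem hu, hcard] at h2
    rw [huv4] at h1
    norm_num at h1 h2
    linarith
  · obtain ⟨u, hu, v, hv, huv, huv2⟩ := hex 2 (by norm_num)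
    have hw3 : ∀ i ∈ S, ∀ j ∈ S, i ≠ j → w i j ≤ 3 := fun i hi j hj hij => by
      have := hpair (by norm_num) i hi j hj hij
      omega
    have huv3 : w u v = 3 := by have := hw3 u hu v hv huv; omega
    have h1 := two_mul_eq_of_pair hsymm hdiag hlam hu hv huv
    have h2 : ∑ z ∈ (S.erase u).erase v, ((w u z + w v z : ℕ) : ℝ) * x z ≤
        ∑ z ∈ (S.erase u).erase v, 4 * x z := by
      refine Finset.sum_le_sum fun z hz => ?_
      obtain ⟨hzS, hzu, hzv⟩ := hmem hz
      have h3 : w u z + w v z ≤ 4 := by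
        have h1 := htri z hzS u hu v hv hzu hzv huv
        have h2 := htri z hzS v hv u hu hzv hzu huv.symm
        rw [hsymm z u, hsymm z v] at h1 h2
        rw [hsymm v u] at h2
        have := hw3 u hu z hzS hzu.symm
        have := hw3 v hv z hzS hzv.symm
        omega
      exact mul_le_mul_of_nonneg_right (by exact_mod_cast h3) (hpos z hzS).le
    rw [← Finset.mul_sum, sum_erase_erase_eq hsum hu hv huv] at h2
    rw [huv3] at h1
    push_cast at h1 h2
    have := hpos u hu
    have := hpos v hv
    linarith
  · exact hlow 2 (fun i hi j hj hij => by have := hpair (by norm_num) i hi j hj hij; omega)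
      (by norm_num)
  · exact hlow 1 (fun i hi j hj hij => by have := hpair (by norm_num) i hi j hj hij; omega)
      (by norm_num)

end Clique

/-- The weighted Turán theorem for weights that admit no `12`-clique. -/
theorem sum_weight_le {ι : Type*} [Fintype ι] [DecidableEq ι] {w : ι → ι → ℕ}
    (hsymm : ∀ i j, w i j = w j i) (hdiag : ∀ i, w i i = 0) (hle : ∀ i j, w i j ≤ 4)
    (hfree : ∀ I K, I.card ≤ 9 → Emb w I K → K ≤ 11) :
    ∑ i, ∑ j, (w i j : ℝ) ≤ 32 / 13 * (Fintype.card ι : ℝ) ^ 2 := by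
  classical
  rcases isEmpty_or_nonempty ι with hι | hι
  · simp
  obtain ⟨x, hx, hmax, hcl, hlam⟩ := exists_maximizer_clique hsymm hdiag
  have hS : ∀ f : ι → ℝ, ∑ i ∈ Finset.univ.filter (fun i => x i ≠ 0), f i * x i =
      ∑ i, f i * x i := fun f => by
    rw [Finset.sum_filter]
    refine Finset.sum_congr rfl fun i _ => ?_
    split_ifs with h
    · rfl
    · rw [not_not.1 h, mul_zero]
  have hbound : quadForm w x ≤ 32 / 13 := by
    refine le_of_clique (S := Finset.univ.filter fun i => x i ≠ 0) (x := x) hsymm hdiag hle hfree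
      ?_ ?_ ?_ ?_
    · intro i hi
      exact lt_of_le_of_ne (hx.1 i) (Ne.symm (Finset.mem_filter.1 hi).2)
    · simpa [hx.2] using hS fun _ => 1
    · intro i hi j hj hij
      exact hcl i j (Finset.mem_filter.1 hi).2 (Finset.mem_filter.1 hj).2 hij
    · intro u hu
      rw [hS, hlam u (Finset.mem_filter.1 hu).2]
  have hcard : (0 : ℝ) < Fintype.card ι := by exact_mod_cast Fintype.card_pos
  -- The total weight is the form at the uniform vector, up to scaling.
  have h1 := hmax (fun _ => (Fintype.card ι : ℝ)⁻¹) ⟨fun _ => by positivity, by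
    simp [hcard.ne']⟩
  have h2 : quadForm w (fun _ => (Fintype.card ι : ℝ)⁻¹) =
      (∑ i, ∑ j, (w i j : ℝ)) / (Fintype.card ι : ℝ) ^ 2 := by
    simp only [quadForm, Finset.sum_div]
    refine Finset.sum_congr rfl fun i _ => Finset.sum_congr rfl fun j _ => ?_
    field_simp
  rw [h2] at h1
  rw [← div_le_iff₀ (by positivity)]
  exact h1.trans hbound


/-! ### Passing to the reduced weighted graph. -/

section Regularity

variable {α : Type*} (G : SimpleGraph α) [DecidableRel G.Adj]

lemma card_interedges_eq_edgeDensity_mul (A B : Finset α) :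
    ((G.interedges A B).card : ℝ) = G.edgeDensity A B * (A.card * B.card) := by
  rw [SimpleGraph.edgeDensity_def]
  push_cast
  rcases Finset.eq_empty_or_nonempty A with rfl | hA
  · simp
  rcases Finset.eq_empty_or_nonempty B with rfl | hB
  · simp [SimpleGraph.interedges_def]
  have := hA.card_pos
  have := hB.card_pos
  field_simp

lemma two_mul_ncard_edgeSet [Fintype α] :
    2 * G.edgeSet.ncard = (G.interedges Finset.univ Finset.univ).card := by
  rw [card_interedges_eq_sum, Set.ncard_eq_toFinset_card', ← SimpleGraph.edgeFinset,
    ← G.sum_degrees_eq_twice_card_edges]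
  refine Finset.sum_congr rfl fun x _ => ?_
  rw [← G.card_neighborFinset_eq_degree, G.neighborFinset_eq_filter]

variable [DecidableEq α]

open scoped Classical in
/-- The weight of a pair of clusters: its density in units of `1 / 4`, rounded up after discarding
`2 * η`, and `0` for irregular pairs. -/
noncomputable def clusterWeight (ε η : ℝ) (A B : Finset α) : ℕ :=
  if A ≠ B ∧ G.IsUniform ε A B then ⌈4 * ((G.edgeDensity A B : ℝ) - 2 * η)⌉₊ else 0

lemma clusterWeight_comm (ε η : ℝ) (A B : Finset α) :
    clusterWeight G ε η A B = clusterWeight G ε η B A := by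
  unfold clusterWeight
  simp only [G.edgeDensity_comm A B, ne_comm (a := A), G.isUniform_comm (s := A)]

lemma clusterWeight_self (ε η : ℝ) (A : Finset α) : clusterWeight G ε η A A = 0 := by
  simp [clusterWeight]

lemma clusterWeight_le {η : ℝ} (hη : 0 ≤ η) (ε : ℝ) (A B : Finset α) :
    clusterWeight G ε η A B ≤ 4 := by
  unfold clusterWeight
  split_ifs
  · rw [Nat.ceil_le]
    have : (G.edgeDensity A B : ℝ) ≤ 1 := by exact_mod_cast G.edgeDensity_le_one A B
    push_cast
    linarith
  · norm_num

lemma edgeDensity_le_clusterWeight {ε η : ℝ} {A B : Finset α} (hAB : A ≠ B)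
    (h : G.IsUniform ε A B) :
    (G.edgeDensity A B : ℝ) ≤ (clusterWeight G ε η A B : ℝ) / 4 + 2 * η := by
  rw [clusterWeight, if_pos ⟨hAB, h⟩]
  have := Nat.le_ceil (4 * ((G.edgeDensity A B : ℝ) - 2 * η))
  linarith

/-- Rounding up gains less than one unit, so the density exceeds (w - 1)/4 + 2η; passing to large
subsets costs less than ε ≤ η. -/
lemma hereditarilyDense_of_clusterWeight {ε η s : ℝ} {A B : Finset α} (hεη : ε ≤ η) (hs : 0 < s)
    (hA : A.card * ε ≤ s) (hB : B.card * ε ≤ s) (hw : 1 ≤ clusterWeight G ε η A B) :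
    HereditarilyDense G s (((clusterWeight G ε η A B : ℝ) - 1) / 4 + η) A B := by
  intro X hX Y hY hsX hsY
  have hunif : A ≠ B ∧ G.IsUniform ε A B := by
    by_contra hc
    rw [clusterWeight, if_neg hc] at hw
    omega
  have h1 := hunif.2 hX hY (hA.trans hsX) (hB.trans hsY)
  have h2 : (clusterWeight G ε η A B : ℝ) - 1 < 4 * ((G.edgeDensity A B : ℝ) - 2 * η) := by
    rw [clusterWeight, if_pos hunif] at hw ⊢
    have := Nat.ceil_lt_add_one (Nat.ceil_pos.1 hw).le
    linarith
  rw [card_interedges_eq_edgeDensity_mul]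
  have h3 := (abs_lt.1 h1).1
  have h4 : (0 : ℝ) < X.card * Y.card := mul_pos (hs.trans_le hsX) (hs.trans_le hsY)
  exact mul_lt_mul_of_pos_right (by linarith) h4

/-- Counting edges along a regular equipartition. -/
lemma two_mul_ncard_edgeSet_le [Fintype α] {ε η : ℝ} (hη : 0 ≤ η) (hε : 0 ≤ ε)
    (P : Finpartition (Finset.univ : Finset α))
    (hP : P.IsEquipartition) (hU : P.IsUniform G ε) :
    2 * (G.edgeSet.ncard : ℝ) ≤ ((Fintype.card α / P.parts.card : ℕ) + 1 : ℝ) ^ 2 *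
      (P.parts.card + ε * (P.parts.card : ℝ) ^ 2 + 2 * η * (P.parts.card : ℝ) ^ 2 +
        (∑ A ∈ P.parts, ∑ B ∈ P.parts, (clusterWeight G ε η A B : ℝ)) / 4) := by
  classical
  set q : ℝ := (Fintype.card α / P.parts.card : ℕ) + 1 with hq
  have hcard : ∀ A ∈ P.parts, (A.card : ℝ) ≤ q := fun A hA => by
    have := hP.card_part_le_average_add_one hA
    rw [Finset.card_univ] at this
    rw [hq]
    exact_mod_cast this
  have h1 : 2 * (G.edgeSet.ncard : ℝ) =
      ∑ A ∈ P.parts, ∑ B ∈ P.parts, ((G.interedges A B).card : ℝ) := by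
    have h := two_mul_ncard_edgeSet G
    rw [SimpleGraph.interedges, Rel.card_interedges_finpartition G.Adj P P, Finset.sum_product] at h
    exact_mod_cast h
  have hterm : ∀ A ∈ P.parts, ∀ B ∈ P.parts, ((G.interedges A B).card : ℝ) ≤
      q ^ 2 * ((if A = B then 1 else 0) + (if (A, B) ∈ P.nonUniforms G ε then 1 else 0) + 2 * η +
        (clusterWeight G ε η A B : ℝ) / 4) := by
    intro A hA B hB
    have hAB : (A.card : ℝ) * B.card ≤ q ^ 2 := by
      rw [sq]
      exact mul_le_mul (hcard A hA) (hcard B hB) (by positivity) (by positivity)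
    have hw : (0 : ℝ) ≤ clusterWeight G ε η A B := by positivity
    have hq2 : 0 ≤ q ^ 2 := sq_nonneg q
    rw [card_interedges_eq_edgeDensity_mul]
    have hd1 : (G.edgeDensity A B : ℝ) ≤ 1 := by exact_mod_cast G.edgeDensity_le_one A B
    have hd0 : (0 : ℝ) ≤ G.edgeDensity A B := by exact_mod_cast G.edgeDensity_nonneg A B
    -- Diagonal and irregular pairs are charged the trivial density 1.
    have hd : (G.edgeDensity A B : ℝ) ≤ (if A = B then 1 else 0) +
        (if (A, B) ∈ P.nonUniforms G ε then 1 else 0) + 2 * η +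
        (clusterWeight G ε η A B : ℝ) / 4 := by
      by_cases hABe : A = B
      · rw [if_pos hABe]
        split_ifs <;> linarith
      · by_cases hu : G.IsUniform ε A B
        · have := edgeDensity_le_clusterWeight G (η := η) hABe hu
          split_ifs <;> linarith
        · rw [if_neg hABe, if_pos ((P.mk_mem_nonUniforms G).2 ⟨hA, hB, hABe, hu⟩)]
          linarith
    calc (G.edgeDensity A B : ℝ) * (A.card * B.card) ≤ G.edgeDensity A B * q ^ 2 := by gcongr
      _ ≤ _ := by rw [mul_comm]; gcongr
  rw [h1]
  refine (Finset.sum_le_sum fun A hA => Finset.sum_le_sum fun B hB => hterm A hA B hB).trans ?_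
  simp only [← Finset.mul_sum]
  refine mul_le_mul_of_nonneg_left ?_ (sq_nonneg q)
  simp only [Finset.sum_add_distrib, ← Finset.sum_div]
  have hd : ∑ A ∈ P.parts, ∑ B ∈ P.parts, (if A = B then (1 : ℝ) else 0) = P.parts.card := by
    simp
  have hn : ∑ A ∈ P.parts, ∑ B ∈ P.parts, (if (A, B) ∈ P.nonUniforms G ε then (1 : ℝ) else 0) ≤
      ε * (P.parts.card : ℝ) ^ 2 := by
    rw [← Finset.sum_product' P.parts P.parts
      (fun A B => if (A, B) ∈ P.nonUniforms G ε then (1 : ℝ) else 0)]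
    have h2 : ∑ x ∈ P.parts ×ˢ P.parts, (if (x.1, x.2) ∈ P.nonUniforms G ε then (1 : ℝ) else 0) ≤
        (P.nonUniforms G ε).card := by
      rw [Finset.sum_boole]
      exact_mod_cast Finset.card_le_card fun x hx => (Finset.mem_filter.1 hx).2
    refine h2.trans (hU.trans ?_)
    have h3 : ((P.parts.card * (P.parts.card - 1) : ℕ) : ℝ) ≤ (P.parts.card : ℝ) ^ 2 := by
      rw [sq]
      exact_mod_cast Nat.mul_le_mul_left _ (Nat.sub_le _ _)
    nlinarith
  have hc : ∑ A ∈ P.parts, ∑ B ∈ P.parts, 2 * η = 2 * η * (P.parts.card : ℝ) ^ 2 := by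
    simp only [Finset.sum_const, nsmul_eq_mul]
    ring
  rw [hd, hc]
  linarith

end Regularity

lemma le_of_count_le {e q m N η : ℝ} (hη0 : 0 ≤ η) (hη1 : η ≤ 1) (hq : 0 ≤ q) (hm : 0 ≤ m)
    (h1 : e ≤ (q + 1) ^ 2 * ((8 / 13 + 4 * η) * m ^ 2)) (h2 : (q + 1) * m ≤ (1 + η) * N) :
    e ≤ (8 / 13 + 32 * η) * N ^ 2 := by
  have h3 : ((q + 1) * m) ^ 2 ≤ ((1 + η) * N) ^ 2 := pow_le_pow_left₀ (by positivity) h2 2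
  have h4 : (1 + η) ^ 2 ≤ 1 + 3 * η := by nlinarith
  have h5 : (1 + 3 * η) * (8 / 13 + 4 * η) ≤ 8 / 13 + 32 * η := by nlinarith
  have h6 : (1 + η) ^ 2 * (8 / 13 + 4 * η) ≤ 8 / 13 + 32 * η :=
    (mul_le_mul_of_nonneg_right h4 (by positivity)).trans h5
  calc e ≤ ((q + 1) * m) ^ 2 * (8 / 13 + 4 * η) := by linarith
    _ ≤ ((1 + η) * N) ^ 2 * (8 / 13 + 4 * η) := mul_le_mul_of_nonneg_right h3 (by positivity)
    _ = (1 + η) ^ 2 * (8 / 13 + 4 * η) * N ^ 2 := by ring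
    _ ≤ _ := mul_le_mul_of_nonneg_right h6 (sq_nonneg N)

/-- A `K_12`-free graph all of whose linear-sized vertex subsets contain a `K_4` has at most
`(4 / 13 + o(1)) n ^ 2` edges. -/
theorem exists_forall_ncard_edgeSet_le {δ : ℝ} (hδ : 0 < δ) (hδ1 : δ ≤ 1) :
    ∃ γ : ℝ, 0 < γ ∧ ∃ N₀ : ℕ, ∀ N ≥ N₀, ∀ G : SimpleGraph (Fin N), G.CliqueFree 12 →
      (∀ X : Finset (Fin N), γ * N ≤ X.card → ∃ Q ⊆ X, G.IsNClique 4 Q) →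
      (G.edgeSet.ncard : ℝ) ≤ (4 / 13 + δ) * (N : ℝ) ^ 2 := by
  classical
  set η : ℝ := δ / 16 with hη
  have hη0 : 0 < η := by positivity
  have hη1 : η ≤ 1 := by rw [hη]; linarith
  set C : ℝ := 16 / η with hC
  have hC16 : 16 ≤ C := by rw [hC, le_div_iff₀ hη0]; linarith
  set ε : ℝ := 1 / (2 * C ^ 9) with hε
  have hC0 : 0 < C := by linarith
  have hε0 : 0 < ε := by positivity
  have hεC : C ^ 9 * (2 * ε) = 1 := by rw [hε]; field_simp
  have hεη : ε ≤ η := by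
    have h1 : C ≤ C ^ 9 := le_self_pow₀ (by linarith) (by norm_num)
    have h2 : C * η = 16 := by rw [hC]; field_simp
    by_contra! hc
    nlinarith
  -- At least 1/η parts make the diagonal contribution `m` at most `η * m ^ 2`.
  set l : ℕ := ⌈1 / η⌉₊ + 1 with hl
  set M : ℕ := SzemerediRegularity.bound ε l with hM
  have hM0 : 0 < M := SzemerediRegularity.bound_pos _ _
  have hM0' : (0 : ℝ) < M := by exact_mod_cast hM0
  -- As N ≤ 2qm ≤ 2qM, this γ gives γN ≤ s. The last bound on N absorbs the rounding of part sizes: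
  -- (q + 1)m ≤ (1 + η)N.
  refine ⟨ε / M, by positivity, max (max M l) ⌈M / η⌉₊, fun N hN G hG hK4 => ?_⟩
  have hNM : M ≤ N := ((le_max_left _ _).trans (le_max_left _ _)).trans hN
  have hNl : l ≤ N := ((le_max_right _ _).trans (le_max_left _ _)).trans hN
  have hNη : (M : ℝ) ≤ η * N := by
    have h1 : (M : ℝ) / η ≤ N := (Nat.le_ceil _).trans (by exact_mod_cast (le_max_right _ _).trans hN)
    rw [div_le_iff₀ hη0] at h1
    linarith
  obtain ⟨P, hPe, hPl, hPM, hPU⟩ := szemeredi_regularity G hε0 (l := l) (by simpa using hNl)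
  set m : ℕ := P.parts.card with hm
  have hm0 : 0 < m := by omega
  have hm0' : (0 : ℝ) < m := by exact_mod_cast hm0
  set q : ℕ := N / m with hq
  have hq1 : 1 ≤ q := (Nat.one_le_div_iff hm0).2 (hPM.trans hNM)
  have hq1' : (1 : ℝ) ≤ q := by exact_mod_cast hq1
  have hqm : q * m ≤ N := Nat.div_mul_le_self N m
  have hqm2 : N ≤ 2 * q * m := by
    have h1 := Nat.lt_div_mul_add (a := N) hm0
    rw [← hq] at h1
    nlinarith
  set s : ℝ := 2 * ε * q with hs
  have hs0 : 0 < s := by positivity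
  have hpart_le : ∀ A ∈ P.parts, (A.card : ℝ) ≤ q + 1 := fun A hA => by
    have := hPe.card_part_le_average_add_one hA
    rw [Finset.card_univ, Fintype.card_fin] at this
    exact_mod_cast this
  have hpart_ge : ∀ A ∈ P.parts, (q : ℝ) ≤ A.card := fun A hA => by
    have := hPe.average_le_card_part hA
    rw [Finset.card_univ, Fintype.card_fin] at this
    exact_mod_cast this
  have hpart_s : ∀ A ∈ P.parts, (A.card : ℝ) * ε ≤ s := fun A hA => by
    have := hpart_le A hA
    rw [hs]
    nlinarith
  let w : {A // A ∈ P.parts} → {A // A ∈ P.parts} → ℕ := fun A B => clusterWeight G ε η A.1 B.1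
  have hlarge : ∀ X : Finset (Fin N), s ≤ X.card → ∃ Q ⊆ X, G.IsNClique 4 Q := by
    intro X hX
    refine hK4 X (le_trans ?_ hX)
    have h1 : (N : ℝ) ≤ 2 * q * m := by exact_mod_cast hqm2
    have h2 : (m : ℝ) ≤ M := by exact_mod_cast hPM
    rw [hs, div_mul_eq_mul_div, div_le_iff₀ hM0']
    calc ε * N ≤ ε * (2 * q * m) := by gcongr
      _ ≤ ε * (2 * q * M) := by gcongr
      _ = _ := by ring
  have hfree : ∀ (I : Finset {A // A ∈ P.parts}) (K : ℕ), I.card ≤ 9 → Emb w I K → K ≤ 11 := by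
    intro I K hI hE
    obtain ⟨T, hT, -⟩ := hE.exists_isNClique G (V := fun A : {A // A ∈ P.parts} => A.1) hη0 hη1 hs0 hlarge
      (fun i j _ hw => hereditarilyDense_of_clusterWeight G hεη hs0 (hpart_s _ i.2)
        (hpart_s _ j.2) hw) (fun A => A.1) (fun _ _ => subset_rfl) (by
          intro i _
          refine le_trans ?_ (hpart_ge _ i.2)
          have h1 : C ^ I.card ≤ C ^ 9 := pow_le_pow_right₀ (by linarith) hI
          calc C ^ I.card * s ≤ C ^ 9 * s := by gcongr
            _ = C ^ 9 * (2 * ε) * q := by rw [hs]; ring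
            _ = q := by rw [hεC, one_mul])
    by_contra! hK
    exact hG.mono hK T hT
  have hsumw := sum_weight_le (w := w) (fun _ _ => clusterWeight_comm _ _ _ _ _)
    (fun _ => clusterWeight_self _ _ _ _) (fun _ _ => clusterWeight_le _ hη0.le _ _ _) hfree
  have hsumw' : ∑ A ∈ P.parts, ∑ B ∈ P.parts, (clusterWeight G ε η A B : ℝ) ≤
      32 / 13 * (m : ℝ) ^ 2 := by
    rw [Fintype.card_coe, ← hm] at hsumw
    refine le_trans (le_of_eq ?_) hsumw
    rw [← Finset.sum_coe_sort P.parts]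
    exact Finset.sum_congr rfl fun A _ => (Finset.sum_coe_sort P.parts _).symm
  have hcount := two_mul_ncard_edgeSet_le G hη0.le hε0.le P hPe hPU
  rw [Fintype.card_fin, ← hm, ← hq] at hcount
  have hml : (m : ℝ) ≤ η * (m : ℝ) ^ 2 := by
    have h1 : 1 / η ≤ m := (Nat.le_ceil _).trans (by exact_mod_cast (by omega : ⌈1 / η⌉₊ ≤ m))
    rw [div_le_iff₀ hη0] at h1
    nlinarith
  have hεm : ε * (m : ℝ) ^ 2 ≤ η * (m : ℝ) ^ 2 := by gcongr
  have h1 : 2 * (G.edgeSet.ncard : ℝ) ≤ ((q : ℝ) + 1) ^ 2 * ((8 / 13 + 4 * η) * (m : ℝ) ^ 2) := by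
    refine hcount.trans (mul_le_mul_of_nonneg_left ?_ (sq_nonneg _))
    linarith
  have h2 : ((q : ℝ) + 1) * m ≤ (1 + η) * N := by
    have h3 : (q : ℝ) * m ≤ N := by exact_mod_cast hqm
    have h4 : (m : ℝ) ≤ M := by exact_mod_cast hPM
    linarith
  have h7 := le_of_count_le hη0.le hη1 q.cast_nonneg m.cast_nonneg h1 h2
  have h8 : 32 * η = 2 * δ := by rw [hη]; ring
  rw [h8] at h7
  linarith


/-! ### Small independence number forces local copies of K_4. -/

/-- If `r` copies of a vertex set `X` spanning no `K_4` cover `N` vertices, then disjoint copies of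
`G[X]` show that `Q(4, N) ≤ r * α(G)`. -/
lemma inverseRamsey_le_mul {α : Type*} [Fintype α] [DecidableEq α] (G : SimpleGraph α)
    (X : Finset α) (hX : ∀ Q ⊆ X, ¬ G.IsNClique 4 Q) {r N : ℕ} (hr : N ≤ r * X.card) :
    inverseRamsey 4 N ≤ r * G.indepNum := by
  classical
  obtain ⟨f⟩ : Nonempty (Fin N ↪ Fin r × X) :=
    Function.Embedding.nonempty_of_card_le (by simpa using hr)
  let H : SimpleGraph (Fin N) :=
    { Adj := fun a b => (f a).1 = (f b).1 ∧ G.Adj (f a).2 (f b).2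
      symm := ⟨fun a b h => ⟨h.1.symm, h.2.symm⟩⟩
      loopless := ⟨fun a h => G.loopless.irrefl _ h.2⟩ }
  have hfree : H.CliqueFree 4 := by
    intro T hT
    have hinj : Set.InjOn (fun a => ((f a).2 : α)) T := by
      intro a ha b hb hab
      by_contra hne
      have := (hT.isClique ha hb hne).2
      simp only at hab
      rw [hab] at this
      exact G.loopless.irrefl _ this
    refine hX (T.image fun a => ((f a).2 : α)) ?_ ⟨?_, ?_⟩
    · intro y hy
      obtain ⟨a, _, rfl⟩ := Finset.mem_image.1 hy
      exact (f a).2.2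
    · rw [Finset.coe_image]
      rintro _ ⟨a, ha, rfl⟩ _ ⟨b, hb, rfl⟩ hab
      exact (hT.isClique ha hb (fun h => hab (h ▸ rfl))).2
    · rw [Finset.card_image_of_injOn hinj, hT.card_eq]
  refine (Nat.sInf_le ⟨H, hfree, rfl⟩ : inverseRamsey 4 N ≤ H.indepNum).trans ?_
  obtain ⟨I, hI⟩ := H.exists_isNIndepSet_indepNum
  rw [← hI.card_eq]
  -- Each copy meets the independent set in a set that projects injectively to an independent set of
  -- `G`.
  have hfib : ∀ c : Fin r, (I.filter fun a => (f a).1 = c).card ≤ G.indepNum := by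
    intro c
    have hinj : Set.InjOn (fun a => ((f a).2 : α)) (I.filter fun a => (f a).1 = c) := by
      intro a ha b hb hab
      rw [Finset.mem_coe, Finset.mem_filter] at ha hb
      exact f.injective (Prod.ext (ha.2.trans hb.2.symm) (Subtype.ext hab))
    rw [← Finset.card_image_of_injOn hinj]
    refine SimpleGraph.IsIndepSet.card_le_indepNum ?_
    rw [Finset.coe_image]
    rintro _ ⟨a, ha, rfl⟩ _ ⟨b, hb, rfl⟩ hab hadj
    rw [Finset.mem_coe, Finset.mem_filter] at ha hb
    exact hI.isIndepSet ha.1 hb.1 (fun h => hab (h ▸ rfl)) ⟨ha.2.trans hb.2.symm, hadj⟩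
  rw [Finset.card_eq_sum_card_fiberwise (f := fun a => (f a).1) (t := Finset.univ)
    (fun _ _ => Finset.mem_coe.2 (Finset.mem_univ _))]
  exact (Finset.sum_le_sum fun c _ => hfib c).trans (by simp)

/-- If the independence number is small compared with `Q(4, N)`, then all vertex sets of linear
size contain a `K_4`. -/
lemma exists_isNClique_of_indepNum_le {N : ℕ} (hN : 0 < N) (G : SimpleGraph (Fin N)) {γ δ : ℝ}
    {r : ℕ} (hr : 1 ≤ r * γ) (hδ : 0 ≤ δ) (hrδ : r * δ < 1)
    (hG : (G.indepNum : ℝ) ≤ δ * inverseRamsey 4 N)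
    (X : Finset (Fin N)) (hX : γ * N ≤ X.card) : ∃ Q ⊆ X, G.IsNClique 4 Q := by
  by_contra! hc
  have h1 : (N : ℝ) ≤ r * X.card := by
    calc (N : ℝ) ≤ r * γ * N := le_mul_of_one_le_left (by positivity) hr
      _ = r * (γ * N) := by ring
      _ ≤ _ := by gcongr
  have h2 : (inverseRamsey 4 N : ℝ) ≤ r * G.indepNum := by
    exact_mod_cast inverseRamsey_le_mul G X hc (by exact_mod_cast h1)
  have h3 : 1 ≤ G.indepNum := by
    have : G.IsIndepSet (({⟨0, hN⟩} : Finset (Fin N)) : Set (Fin N)) := by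
      rw [Finset.coe_singleton]
      exact Set.pairwise_singleton _ _
    simpa using this.card_le_indepNum
  have h3' : (1 : ℝ) ≤ G.indepNum := by exact_mod_cast h3
  have h4 : δ * inverseRamsey 4 N ≤ δ * (r * G.indepNum) := by gcongr
  -- With α the independence number, α ≤ δQ ≤ rδα < α, using α ≥ 1.
  nlinarith

/-! ### Existence of the limit and the final bound. -/

section Density

variable {W : Type*} (H : SimpleGraph W)

lemma ramseyTuran_le_of_forall {n B : ℕ} {x : ℝ}
    (h : ∀ G : SimpleGraph (Fin n), H.Free G → (G.indepNum : ℝ) ≤ x → G.edgeSet.ncard ≤ B) :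
    ramseyTuran n H x ≤ B := by
  refine csSup_le' ?_
  rintro e ⟨G, hG, hGx, rfl⟩
  exact h G hG hGx

lemma ncard_edgeSet_le_sq {n : ℕ} (G : SimpleGraph (Fin n)) : G.edgeSet.ncard ≤ n ^ 2 := by
  classical
  rw [Set.ncard_eq_toFinset_card', ← SimpleGraph.edgeFinset]
  refine G.card_edgeFinset_le_card_choose_two.trans ?_
  rw [Fintype.card_fin]
  exact Nat.choose_le_pow n 2

lemma ramseyTuran_mono {n : ℕ} {x y : ℝ} (hxy : x ≤ y) :
    ramseyTuran n H x ≤ ramseyTuran n H y := by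
  refine ramseyTuran_le_of_forall H fun G hG hGx => ?_
  refine le_csSup ⟨n ^ 2, ?_⟩ ⟨G, hG, hGx.trans hxy, rfl⟩
  rintro e ⟨G', _, _, rfl⟩
  exact ncard_edgeSet_le_sq G'

lemma ramseyTuran_div_sq_le_one (n : ℕ) (x : ℝ) :
    (ramseyTuran n H x : ℝ) / (n : ℝ) ^ 2 ≤ 1 := by
  refine div_le_one_of_le₀ ?_ (by positivity)
  exact_mod_cast ramseyTuran_le_of_forall H fun G _ _ => ncard_edgeSet_le_sq G

lemma isCoboundedUnder_ramseyTuran (f : ℕ → ℝ) : IsCoboundedUnder (· ≤ ·) atTop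
    fun n : ℕ => (ramseyTuran n H (f n) : ℝ) / (n : ℝ) ^ 2 :=
  IsBoundedUnder.isCoboundedUnder_le ⟨0, by
    rw [eventually_map]
    exact Eventually.of_forall fun n => by positivity⟩

lemma isBoundedUnder_ramseyTuran (f : ℕ → ℝ) : IsBoundedUnder (· ≤ ·) atTop
    fun n : ℕ => (ramseyTuran n H (f n) : ℝ) / (n : ℝ) ^ 2 :=
  ⟨1, by
    rw [eventually_map]
    exact Eventually.of_forall fun n => ramseyTuran_div_sq_le_one H n (f n)⟩

lemma upperDensity_mono {f g : ℕ → ℝ} (h : ∀ n, f n ≤ g n) :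
    upperDensity H f ≤ upperDensity H g := by
  refine limsup_le_limsup (Eventually.of_forall fun n => ?_) (isCoboundedUnder_ramseyTuran H f)
    (isBoundedUnder_ramseyTuran H g)
  have : (ramseyTuran n H (f n) : ℝ) ≤ ramseyTuran n H (g n) := by
    exact_mod_cast ramseyTuran_mono H (h n)
  simp only
  gcongr

lemma upperDensity_nonneg (f : ℕ → ℝ) : 0 ≤ upperDensity H f :=
  le_limsup_of_le (isBoundedUnder_ramseyTuran H f) fun _ hb =>
    let ⟨_, hn⟩ := hb.exists
    le_trans (by positivity) hn

/-- The Ramsey-Turán density with respect to `o(f)` always exists. -/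
theorem isLittleODensity_sInf {f : ℕ → ℝ} (hf : ∀ n, 0 ≤ f n) :
    IsLittleODensity H f (sInf ((fun δ : ℝ => upperDensity H fun n => δ * f n) '' Set.Ioi 0)) := by
  -- Enlarging δ only relaxes the constraint, so the right limit at 0 is the infimum over δ > 0; any
  -- single δ then bounds it.
  have hmono : Monotone fun δ : ℝ => upperDensity H fun n => δ * f n :=
    fun _ _ h => upperDensity_mono H fun n => mul_le_mul_of_nonneg_right h (hf n)
  exact hmono.tendsto_nhdsGT 0

end Density

theorem exists_upperDensity_le {ε : ℝ} (hε : 0 < ε) (hε1 : ε ≤ 1) :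
    ∃ δ : ℝ, 0 < δ ∧ upperDensity (SimpleGraph.completeGraph (Fin 12))
      (fun n => δ * (inverseRamsey 4 n : ℝ)) ≤ 4 / 13 + ε := by
  obtain ⟨γ, hγ, N₀, hN₀⟩ := exists_forall_ncard_edgeSet_le hε hε1
  set r : ℕ := ⌈1 / γ⌉₊ with hr
  have hrγ : 1 ≤ r * γ := by
    rw [← div_le_iff₀ hγ]
    exact Nat.le_ceil _
  -- The denominator `r + 1` rather than `r` makes `r * δ < 1` strict.
  refine ⟨1 / (r + 1), by positivity,
    limsup_le_of_le (isCoboundedUnder_ramseyTuran _ _) ?_⟩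
  filter_upwards [eventually_ge_atTop N₀, eventually_gt_atTop 0] with N hN hN0
  have hN0' : (0 : ℝ) < N := by exact_mod_cast hN0
  rw [div_le_iff₀ (by positivity)]
  have hle : ramseyTuran N (SimpleGraph.completeGraph (Fin 12))
      (1 / ((r : ℝ) + 1) * (inverseRamsey 4 N : ℝ)) ≤ ⌊(4 / 13 + ε) * (N : ℝ) ^ 2⌋₊ := by
    refine ramseyTuran_le_of_forall _ fun G hG hGx => Nat.le_floor ?_
    refine hN₀ N hN G ?_ fun X hX => exists_isNClique_of_indepNum_le hN0 G hrγ (by positivity)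
      ?_ hGx X hX
    · by_contra hc
      exact hG ((SimpleGraph.not_cliqueFree_iff_top_isContained 12).1 hc)
    · rw [mul_one_div, div_lt_one (by positivity)]
      linarith
  exact (Nat.cast_le.2 hle).trans (Nat.floor_le (by positivity))

end RamseyTuran

theorem mainTheorem3 :
    ∃ c : ℝ, RamseyTuran.IsLittleODensity (SimpleGraph.completeGraph (Fin 12))
        (fun n => (RamseyTuran.inverseRamsey 4 n : ℝ)) c ∧
      c ≤ 4 / 13 := by
  refine ⟨_, RamseyTuran.isLittleODensity_sInf _ fun n => Nat.cast_nonneg _, ?_⟩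
  refine le_of_forall_pos_le_add fun ε hε => ?_
  obtain ⟨δ, hδ, h⟩ := RamseyTuran.exists_upperDensity_le (ε := min ε 1) (by positivity)
    (min_le_right _ _)
  have hbdd : BddBelow ((fun δ : ℝ => RamseyTuran.upperDensity
      (SimpleGraph.completeGraph (Fin 12)) fun n => δ * (RamseyTuran.inverseRamsey 4 n : ℝ)) ''
        Set.Ioi 0) := by
    refine ⟨0, ?_⟩
    rintro _ ⟨δ', _, rfl⟩
    exact RamseyTuran.upperDensity_nonneg _ _
  exact (csInf_le hbdd ⟨δ, hδ, rfl⟩).trans (h.trans (by gcongr; exact min_le_left _ _))
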